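/- For $m\ge 0$ and $0\le r\le m$ let $\mathrm{RM}(r,m)\subseteq\mathbb F_2^{2^m}$ be the binary Reed--Muller code, defined recursively by $\mathrm{RM}(0,m)=\{\overline 0,\overline 1\}$, $\mathrm{RM}(m,m)=\mathbb F_2^{2^m}$, and, for $1\le r\le m-1$, $$\mathrm{RM}(r,m)=\{(\overline u,\overline u+\overline v) : \overline u\in \mathrm{RM}(r,m-1),\ \overline v\in \mathrm{RM}(r-1,m-1)\}.$$ For a linear code $C\subseteq\mathbb F_q^n$ and $t\in\mathbb N$, let $R_t(C)$, the $t$-th generalized covering radius of $C$, be the least integer $\rho$ such that for every matrix $\mathbf v\in\mathbb F_q^{t\times n}$ there is a matrix $\mathbf c\in\mathbb F_q^{t\times n}$, all of whose rows are codewords of $C$, such that $\mathbf v-\mathbf c$ has at most $\rho$ nonzero columns. Write $R_t(r,m)=R_t(\mathrm{RM}(r,m))$. **Theorem.** Fix integers $r\ge 1$ and $t\in\mathbb N$. Then for all integers $m\ge r$, $$R_t(r,m)\le\left(1-\frac1{2^t}\right)2^m-\frac{\sqrt{2^t-1}}{2^t}\,(1+\sqrt2)^{r-1}\,2^{m/2}+O(m^{r-2}),$$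 where the constant implied by $O(\cdot)$, as $m\to\infty$, depends only on $r$ and $t$. (For $r=1$ the error term is $O(m^{-1})$.) -/

import Mathlib

open Filter Asymptotics

namespace GenCovering

section Radius

variable {F : Type*} [Field F] {t n : ℕ}

/-- The `t`-weight of a `t × n` matrix: the size of the union of the supports of its rows. -/
noncomputable def tWeight (v : Matrix (Fin t) (Fin n) F) : ℕ :=
  (⋃ i : Fin t, Function.support (v i)).ncard

/-- The metric on `t × n` matrices induced by the `t`-weight. -/
noncomputable def tDist (v u : Matrix (Fin t) (Fin n) F) : ℕ :=
  tWeight (v - u)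

/-- The ball of radius `ρ` centred at `v` in the metric `tDist`. -/
def tBall (ρ : ℕ) (v : Matrix (Fin t) (Fin n) F) : Set (Matrix (Fin t) (Fin n) F) :=
  {v' | tDist v v' ≤ ρ}

/-- `C ^ t`: the `t × n` matrices all of whose rows are codewords of `C`. -/
def codePow (t : ℕ) (C : Submodule F (Fin n → F)) : Set (Matrix (Fin t) (Fin n) F) :=
  {c | ∀ i, c i ∈ C}

/-- The `t`-th generalized covering radius of a linear code `C` of length `n`: the least `ρ` such
that the balls of radius `ρ` centred at the points of `C ^ t` cover the space of all
`t × n` matrices. -/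
noncomputable def coveringRadius (t : ℕ) (C : Submodule F (Fin n → F)) : ℕ :=
  sInf {ρ : ℕ | ⋃ c ∈ codePow t C, tBall ρ c = Set.univ}

theorem tWeight_le (v : Matrix (Fin t) (Fin n) F) : tWeight v ≤ n := by
  unfold tWeight
  calc (⋃ i : Fin t, Function.support (v i)).ncard
      ≤ (Set.univ : Set (Fin n)).ncard := Set.ncard_le_ncard (Set.subset_univ _) Set.finite_univ
    _ = n := by simp

/-- The minimum that defines `coveringRadius` is attained. -/
theorem coveringRadius_isLeast (t : ℕ) (C : Submodule F (Fin n → F)) :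
    IsLeast {ρ : ℕ | ⋃ c ∈ codePow t C, tBall ρ c = Set.univ} (coveringRadius t C) := by
  have hne : {ρ : ℕ | ⋃ c ∈ codePow t C, tBall ρ c = Set.univ}.Nonempty := by
    refine ⟨n, ?_⟩
    refine Set.eq_univ_of_forall fun v => ?_
    refine Set.mem_biUnion (x := (0 : Matrix (Fin t) (Fin n) F)) (fun i => C.zero_mem) ?_
    exact tWeight_le _
  exact ⟨Nat.sInf_mem hne, fun ρ hρ => Nat.sInf_le hρ⟩

end Radius

/-- The binary repetition code `{0, 1}` of length `n`. -/
def repetitionCode (n : ℕ) : Submodule (ZMod 2) (Fin n → ZMod 2) where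
  carrier := {0, 1}
  zero_mem' := Or.inl rfl
  add_mem' := by
    have h : (1 : Fin n → ZMod 2) + 1 = 0 := funext fun _ => by
      change (1 : ZMod 2) + 1 = 0
      decide
    rintro a b (rfl | rfl) (rfl | rfl) <;> simp [h]
  smul_mem' := by
    intro c x hx
    fin_cases c
    · left
      exact zero_smul (ZMod 2) x
    · have h : (1 : ZMod 2) • x = x := one_smul _ x
      exact h.symm ▸ hx

/-- The `(u, u + v)` construction: the code of all concatenations `(u, u + v)` with `u ∈ C₁` and
`v ∈ C₂`. -/
def uuvCode {F : Type*} [Field F] {n : ℕ} (C₁ C₂ : Submodule F (Fin n → F)) :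
    Submodule F (Fin (n + n) → F) where
  carrier := {w | ∃ u ∈ C₁, ∃ v ∈ C₂, w = Fin.append u (u + v)}
  zero_mem' := ⟨0, C₁.zero_mem, 0, C₂.zero_mem, by
    funext j
    refine Fin.addCases (fun i => ?_) (fun i => ?_) j
    · simp
    · rw [Fin.append_right]
      simp⟩
  add_mem' := by
    rintro _ _ ⟨u, hu, v, hv, rfl⟩ ⟨u', hu', v', hv', rfl⟩
    refine ⟨u + u', C₁.add_mem hu hu', v + v', C₂.add_mem hv hv', ?_⟩
    funext j
    refine Fin.addCases (fun i => ?_) (fun i => ?_) j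
    · simp
    · simp only [Pi.add_apply, Fin.append_right]
      ring
  smul_mem' := by
    rintro c _ ⟨u, hu, v, hv, rfl⟩
    refine ⟨c • u, C₁.smul_mem c hu, c • v, C₂.smul_mem c hv, ?_⟩
    funext j
    refine Fin.addCases (fun i => ?_) (fun i => ?_) j
    · simp
    · simp only [Pi.smul_apply, Pi.add_apply, Fin.append_right, smul_eq_mul]
      ring

/-- A code of length `n`, regarded as a code of length `n'` along an equality `n' = n`. -/
def castCode {F : Type*} [Field F] {n n' : ℕ} (h : n' = n) (C : Submodule F (Fin n → F)) :
    Submodule F (Fin n' → F) :=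
  C.comap (LinearMap.funLeft F F (Fin.cast h.symm))

/-- The Reed-Muller code `RM(r, m)`, of length `2 ^ m`. It is the repetition code for `r = 0`, the
whole space for `r = m`, and for `1 ≤ r ≤ m - 1` it is obtained from `RM(r, m - 1)` and
`RM(r - 1, m - 1)` by the `(u, u + v)` construction.
(For `r > m`, where it is usually left undefined, the value here is the whole space.) -/
def reedMuller : (m r : ℕ) → Submodule (ZMod 2) (Fin (2 ^ m) → ZMod 2)
  | m, 0 => repetitionCode (2 ^ m)
  | 0, _ + 1 => ⊤
  | m + 1, r + 1 =>
    if m ≤ r then ⊤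
    else castCode (by rw [pow_succ, mul_two]) (uuvCode (reedMuller m (r + 1)) (reedMuller m r))

/-- `R_t(r, m)`: the `t`-th generalized covering radius of `RM(r, m)`. -/
noncomputable def rmRadius (t r m : ℕ) : ℕ :=
  coveringRadius t (reedMuller m r)

end GenCovering

/-! For `r = 1` the bound is probabilistic and has no error term. Any coordinate of a word of
RM(1,m) can be set to 1 while two others are 0, so for a uniformly random matrix of codewords the
agreements with `v` in different columns are 3-wise independent, each of probability p = 2^(-t). The
centred number of agreements D has mean 0, variance σ² = 2^m p(1-p) and nonnegative third moment, so
some matrix has D ≥ σ (`exists_le_of_moments`); it differs from `v` in 2^m(1-p) - D columns.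

For larger `r`, the (u, u+v) construction makes the radius subadditive
(`coveringRadius_uuvCode_le`). The main term satisfies the same recursion with equality
(`radiusBound_succ_succ`), so only the initial values at `m = r` produce an error, which grows by
one power of `m` per step in `r`. -/

namespace GenCovering

/-! ### Covering radii and the (u, u+v) construction -/

section CoveringRadius

variable {F : Type*} [Field F] {t n : ℕ}

/-- The number of columns in which two families of `t` words of length `n` differ. -/
noncomputable def columnDist (c v : Fin t → Fin n → F) : ℕ := by
  classical exact (Finset.univ.filter fun x => ∃ i, c i x ≠ v i x).card

theorem tDist_eq_columnDist (c v : Matrix (Fin t) (Fin n) F) : tDist c v = columnDist c v := by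
  classical
  have h : ⋃ i, Function.support ((c - v) i) =
      (Finset.univ.filter fun x => ∃ i, c i x ≠ v i x : Finset (Fin n)) := by
    ext x
    simp [sub_eq_zero]
  exact (congrArg Set.ncard h).trans (Set.ncard_coe_finset _)

theorem coveringRadius_le {C : Submodule F (Fin n → F)} {ρ : ℕ}
    (h : ∀ v : Fin t → Fin n → F, ∃ c : Fin t → Fin n → F, (∀ i, c i ∈ C) ∧ columnDist c v ≤ ρ) :
    coveringRadius t C ≤ ρ := by
  refine (coveringRadius_isLeast t C).2 (Set.eq_univ_of_forall fun v => ?_)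
  obtain ⟨c, hc, hcv⟩ := h v
  exact Set.mem_biUnion (x := (c : Matrix (Fin t) (Fin n) F)) hc
    ((tDist_eq_columnDist c v).trans_le hcv)

theorem exists_columnDist_le_coveringRadius (C : Submodule F (Fin n → F))
    (v : Fin t → Fin n → F) :
    ∃ c : Fin t → Fin n → F, (∀ i, c i ∈ C) ∧ columnDist c v ≤ coveringRadius t C := by
  have h : (v : Matrix (Fin t) (Fin n) F) ∈
      ⋃ c ∈ codePow t C, tBall (coveringRadius t C) c := by
    rw [(coveringRadius_isLeast t C).1]
    exact Set.mem_univ _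
  obtain ⟨c, hc, hcv⟩ := Set.mem_iUnion₂.1 h
  exact ⟨c, hc, (tDist_eq_columnDist c v).symm.trans_le hcv⟩

theorem coveringRadius_le_real {C : Submodule F (Fin n → F)} {B : ℝ}
    (h : ∀ v : Fin t → Fin n → F, ∃ c : Fin t → Fin n → F,
      (∀ i, c i ∈ C) ∧ (columnDist c v : ℝ) ≤ B) :
    (coveringRadius t C : ℝ) ≤ B := by
  have hB : 0 ≤ B := by
    obtain ⟨c, -, hc⟩ := h 0
    exact (Nat.cast_nonneg _).trans hc
  refine le_trans (Nat.cast_le.2 (coveringRadius_le (ρ := ⌊B⌋₊) fun v => ?_)) (Nat.floor_le hB)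
  obtain ⟨c, hc, hcv⟩ := h v
  exact ⟨c, hc, Nat.le_floor hcv⟩

theorem coveringRadius_top : coveringRadius t (⊤ : Submodule F (Fin n → F)) = 0 :=
  Nat.le_zero.1 (coveringRadius_le fun v => ⟨v, fun _ => Submodule.mem_top, by simp [columnDist]⟩)

theorem coveringRadius_castCode {n' : ℕ} (h : n' = n) (C : Submodule F (Fin n → F)) :
    coveringRadius t (castCode h C) = coveringRadius t C := by
  subst h
  rfl

/-- Approximate the left half first, then correct what remains on the right half with the second
code. -/
theorem coveringRadius_uuvCode_le (C₁ C₂ : Submodule F (Fin n → F)) :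
    coveringRadius t (uuvCode C₁ C₂) ≤ coveringRadius t C₁ + coveringRadius t C₂ := by
  classical
  refine coveringRadius_le fun v => ?_
  obtain ⟨a, ha, hav⟩ :=
    exists_columnDist_le_coveringRadius C₁ (fun i x => v i (Fin.castAdd n x))
  obtain ⟨b, hb, hbv⟩ :=
    exists_columnDist_le_coveringRadius C₂ (fun i x => v i (Fin.natAdd n x) - a i x)
  refine ⟨fun i => Fin.append (a i) (a i + b i), fun i => ⟨a i, ha i, b i, hb i, rfl⟩, ?_⟩
  refine le_trans (le_of_eq ?_) (add_le_add hav hbv)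
  simp only [columnDist, Finset.card_filter, Fin.sum_univ_add, Fin.append_left, Fin.append_right,
    Pi.add_apply, ne_eq, eq_sub_iff_add_eq']

end CoveringRadius

/-! ### The moment method for codes of strength three -/

section Moments

variable {F : Type*} [Field F] [Fintype F] [DecidableEq F] {t n : ℕ}

/-- The indicator of the event that two matrices agree in column `x`, centred at its mean
`1 / |F| ^ t`. -/
noncomputable def centredAgreement (v c : Fin t → Fin n → F) (x : Fin n) : ℝ :=
  (if ∀ i, c i x = v i x then 1 else 0) - 1 / (Fintype.card F : ℝ) ^ t

-- A two-valued variable satisfies a quadratic equation, which reduces its second and third moments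
-- to its mean.
omit [Field F] in
theorem centredAgreement_sq (v c : Fin t → Fin n → F) (x : Fin n) :
    centredAgreement v c x ^ 2 =
      (1 - 2 * (1 / (Fintype.card F : ℝ) ^ t)) * centredAgreement v c x
        + 1 / (Fintype.card F : ℝ) ^ t * (1 - 1 / (Fintype.card F : ℝ) ^ t) := by
  unfold centredAgreement
  split_ifs <;> ring

omit [Field F] in
theorem sum_centredAgreement (v c : Fin t → Fin n → F) :
    ∑ x, centredAgreement v c x =
      n - columnDist c v - n * (1 / (Fintype.card F : ℝ) ^ t) := by
  have h := Finset.card_filter_add_card_filter_not (s := (Finset.univ : Finset (Fin n)))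
    (fun x => ∀ i, c i x = v i x)
  have hw : columnDist c v = (Finset.univ.filter fun x => ¬ ∀ i, c i x = v i x).card := by
    rw [columnDist]
    congr 1
    ext x
    simp
  rw [← hw, Finset.card_univ, Fintype.card_fin] at h
  have h' : ((Finset.univ.filter fun x => ∀ i, c i x = v i x).card : ℝ) + columnDist c v = n := by
    exact_mod_cast h
  simp only [centredAgreement, Finset.sum_sub_distrib, Finset.sum_boole, Finset.sum_const,
    Finset.card_univ, Fintype.card_fin, nsmul_eq_mul]
  linarith

/-- Exactly one of the shifts `w` makes column `x` agree. -/
theorem sum_shift_centredAgreement (v c : Fin t → Fin n → F) {e : Fin n → F} {x : Fin n}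
    (hx : e x = 1) :
    ∑ w : Fin t → F, centredAgreement v (fun i => c i + w i • e) x = 0 := by
  have h : ∀ w : Fin t → F, (∀ i, (c i + w i • e) x = v i x) ↔ w = fun i => v i x - c i x := by
    intro w
    simp only [Pi.add_apply, Pi.smul_apply, hx, smul_eq_mul, mul_one, funext_iff, eq_sub_iff_add_eq']
  have hq : (Fintype.card F : ℝ) ^ t ≠ 0 := pow_ne_zero _ (Nat.cast_ne_zero.2 Fintype.card_ne_zero)
  simp only [centredAgreement, h, Finset.sum_sub_distrib, Finset.sum_ite_eq', Finset.mem_univ,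
    if_true, Finset.sum_const, Finset.card_univ, Fintype.card_fun, Fintype.card_fin, nsmul_eq_mul,
    Nat.cast_pow]
  field_simp
  ring

variable (C : Submodule F (Fin n → F)) [Fintype C]

/-- Averaging over a line of codeword matrices kills an agreement that is independent of the
remaining factor. -/
theorem sum_centredAgreement_mul_eq_zero (v : Fin t → Fin n → F) {e : Fin n → F}
    (he : e ∈ C) {x : Fin n} (hx : e x = 1) (G : (Fin t → C) → ℝ)
    (hG : ∀ (c : Fin t → C) (w : Fin t → F), G (fun i => c i + w i • (⟨e, he⟩ : C)) = G c) :
    ∑ c : Fin t → C, centredAgreement v (fun i => (c i : Fin n → F)) x * G c = 0 := by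
  set S := ∑ c : Fin t → C, centredAgreement v (fun i => (c i : Fin n → F)) x * G c with hS
  have key : ∀ w : Fin t → F, S = ∑ c : Fin t → C,
      centredAgreement v (fun i => (c i : Fin n → F) + w i • e) x * G c := by
    intro w
    rw [hS, ← Equiv.sum_comp (Equiv.addRight (fun i => w i • (⟨e, he⟩ : C)))]
    refine Finset.sum_congr rfl fun c _ => ?_
    congr 1
    exact hG c w
  have hsum : ∑ _w : Fin t → F, S = 0 := by
    rw [Finset.sum_congr rfl fun w _ => key w, Finset.sum_comm]
    refine Finset.sum_eq_zero fun c _ => ?_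
    rw [← Finset.sum_mul, sum_shift_centredAgreement v _ hx, zero_mul]
  simpa using hsum

variable {C}

/-- A code has strength three if each coordinate can be prescribed to be `1` while any two others
are prescribed to be `0`. -/
def HasStrengthThree {n : ℕ} (C : Submodule F (Fin n → F)) : Prop :=
  ∀ (S : Finset (Fin n)) (x : Fin n), S.card ≤ 2 → x ∉ S →
    ∃ e ∈ C, e x = 1 ∧ ∀ y ∈ S, e y = 0

/-- Adding multiples of a codeword that is 1 at `x` and 0 on `S` randomizes column `x` and leaves
the columns in `S` fixed. -/
theorem sum_centredAgreement_mul_prod_eq_zero (hC : HasStrengthThree C)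
    (v : Fin t → Fin n → F) {S : Finset (Fin n)} {x : Fin n} (hS : S.card ≤ 2)
    (hx : x ∉ S) (G : (Fin n → ℝ) → ℝ) (hG : ∀ f g : Fin n → ℝ, (∀ y ∈ S, f y = g y) → G f = G g) :
    ∑ c : Fin t → C, centredAgreement v (fun i => (c i : Fin n → F)) x *
      G (centredAgreement v (fun i => (c i : Fin n → F))) = 0 := by
  obtain ⟨e, he, hex, heS⟩ := hC S x hS hx
  refine sum_centredAgreement_mul_eq_zero C v he hex _ fun c w => hG _ _ fun y hy => ?_
  simp [centredAgreement, heS y hy]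

theorem sum_centredAgreement_eq_zero (hC : HasStrengthThree C) (v : Fin t → Fin n → F)
    (x : Fin n) :
    ∑ c : Fin t → C, centredAgreement v (fun i => (c i : Fin n → F)) x = 0 := by
  simpa using sum_centredAgreement_mul_prod_eq_zero hC v (S := ∅) (x := x) (by simp) (by simp)
    (fun _ => 1) (fun _ _ _ => rfl)

theorem sum_centredAgreement_mul (hC : HasStrengthThree C) (v : Fin t → Fin n → F)
    (x y : Fin n) :
    ∑ c : Fin t → C, centredAgreement v (fun i => (c i : Fin n → F)) x *
        centredAgreement v (fun i => (c i : Fin n → F)) y =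
      if x = y then Fintype.card (Fin t → C) *
        (1 / (Fintype.card F : ℝ) ^ t * (1 - 1 / (Fintype.card F : ℝ) ^ t)) else 0 := by
  split_ifs with h
  · subst h
    simp only [← sq, centredAgreement_sq, Finset.sum_add_distrib, ← Finset.mul_sum,
      sum_centredAgreement_eq_zero hC, Finset.sum_const, Finset.card_univ, nsmul_eq_mul]
    ring
  · exact sum_centredAgreement_mul_prod_eq_zero hC v (S := {y}) (x := x) (by simp) (by simpa using h)
      (fun f => f y) (fun f g hfg => hfg y (by simp))

theorem sum_centredAgreement_mul_mul (hC : HasStrengthThree C) (v : Fin t → Fin n → F)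
    (x y z : Fin n) :
    ∑ c : Fin t → C, centredAgreement v (fun i => (c i : Fin n → F)) x *
        (centredAgreement v (fun i => (c i : Fin n → F)) y *
          centredAgreement v (fun i => (c i : Fin n → F)) z) =
      if x = y then if x = z then Fintype.card (Fin t → C) *
        ((1 - 2 * (1 / (Fintype.card F : ℝ) ^ t)) *
          (1 / (Fintype.card F : ℝ) ^ t * (1 - 1 / (Fintype.card F : ℝ) ^ t))) else 0 else 0 := by
  have aux : ∀ x y z : Fin n, x ≠ y → x ≠ z →
      ∑ c : Fin t → C, centredAgreement v (fun i => (c i : Fin n → F)) x *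
        (centredAgreement v (fun i => (c i : Fin n → F)) y *
          centredAgreement v (fun i => (c i : Fin n → F)) z) = 0 := fun x y z hy hz =>
    sum_centredAgreement_mul_prod_eq_zero hC v (S := {y, z}) (x := x) Finset.card_le_two
      (by simp [hy, hz]) (fun f => f y * f z)
      (fun f g hfg => by rw [hfg y (by simp), hfg z (by simp)])
  split_ifs with hy hz
  · subst hy hz
    have h : ∀ c : Fin t → C, centredAgreement v (fun i => (c i : Fin n → F)) x *
        (centredAgreement v (fun i => (c i : Fin n → F)) x *
          centredAgreement v (fun i => (c i : Fin n → F)) x) =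
        (1 - 2 * (1 / (Fintype.card F : ℝ) ^ t)) *
          (centredAgreement v (fun i => (c i : Fin n → F)) x *
            centredAgreement v (fun i => (c i : Fin n → F)) x) +
        1 / (Fintype.card F : ℝ) ^ t * (1 - 1 / (Fintype.card F : ℝ) ^ t) *
          centredAgreement v (fun i => (c i : Fin n → F)) x := by
      intro c
      rw [← sq, centredAgreement_sq, mul_add, mul_left_comm, mul_comm (centredAgreement _ _ _)
        (1 / (Fintype.card F : ℝ) ^ t * (1 - 1 / (Fintype.card F : ℝ) ^ t)), ← sq,
        centredAgreement_sq]
    simp only [h, Finset.sum_add_distrib, ← Finset.mul_sum, sum_centredAgreement_eq_zero hC,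
      sum_centredAgreement_mul hC, if_true]
    ring
  · subst hy
    rw [← aux z x x (Ne.symm hz) (Ne.symm hz)]
    exact Finset.sum_congr rfl fun c _ => by ring
  · by_cases hz : x = z
    · subst hz
      rw [← aux y x x (Ne.symm hy) (Ne.symm hy)]
      exact Finset.sum_congr rfl fun c _ => by ring
    · exact aux x y z hy hz

/-- A function with mean zero, variance `σ ^ 2` and nonnegative third moment attains a value that
is at least `σ`. -/
theorem exists_le_of_moments {ι : Type*} [Fintype ι] [Nonempty ι] (D : ι → ℝ) {σ : ℝ}
    (h1 : ∑ i, D i = 0) (h2 : ∑ i, D i ^ 2 = Fintype.card ι * σ ^ 2)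
    (h3 : 0 ≤ ∑ i, D i ^ 3) : ∃ i, σ ≤ D i := by
  by_contra! hlt
  have hnonneg : ∀ i ∈ Finset.univ, 0 ≤ (σ - D i) * (σ + D i) ^ 2 := fun i _ =>
    mul_nonneg (sub_nonneg.2 (hlt i).le) (sq_nonneg _)
  -- The double root at -σ makes the cubic nonnegative for values below σ; in the sum, the first two
  -- moments cancel.
  have hsum : ∑ i, (σ - D i) * (σ + D i) ^ 2 = -∑ i, D i ^ 3 := by
    have h : ∀ i, (σ - D i) * (σ + D i) ^ 2 =
        σ ^ 3 + σ ^ 2 * D i - σ * D i ^ 2 - D i ^ 3 := fun i => by ring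
    simp only [h, Finset.sum_sub_distrib, Finset.sum_add_distrib, ← Finset.mul_sum, h1, h2,
      Finset.sum_const, Finset.card_univ, nsmul_eq_mul]
    ring
  have hzero : ∑ i, (σ - D i) * (σ + D i) ^ 2 = 0 :=
    le_antisymm (hsum.trans_le (neg_nonpos.2 h3)) (Finset.sum_nonneg hnonneg)
  have hD : ∀ i, D i = -σ := fun i => by
    have h := (Finset.sum_eq_zero_iff_of_nonneg hnonneg).1 hzero i (Finset.mem_univ i)
    have h' := (mul_eq_zero.1 h).resolve_left (sub_pos.2 (hlt i)).ne'
    linarith [pow_eq_zero_iff (two_ne_zero) |>.1 h']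
  obtain ⟨i⟩ := ‹Nonempty ι›
  have hσ0 : σ = 0 := by
    have : (Fintype.card ι : ℝ) ≠ 0 := Nat.cast_ne_zero.2 (Fintype.card_pos_iff.2 ⟨i⟩).ne'
    simpa [hD, this] using h1
  have := hlt i
  rw [hD i, hσ0] at this
  simp at this

/-- A code of strength three has a small generalized covering radius. -/
theorem coveringRadius_le_of_hasStrengthThree (hC : HasStrengthThree C) :
    (coveringRadius t C : ℝ) ≤ n - n * (1 / (Fintype.card F : ℝ) ^ t) -
      Real.sqrt (n * (1 / (Fintype.card F : ℝ) ^ t * (1 - 1 / (Fintype.card F : ℝ) ^ t))) := by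
  refine coveringRadius_le_real fun v => ?_
  have hp0 : 0 ≤ 1 / (Fintype.card F : ℝ) ^ t := by positivity
  have hq : (2 : ℝ) ≤ Fintype.card F := by exact_mod_cast Fintype.one_lt_card (α := F)
  have hp1 : 0 ≤ 1 - 1 / (Fintype.card F : ℝ) ^ t := by
    rw [sub_nonneg]
    exact div_le_one_of_le₀ (one_le_pow₀ (by linarith)) (by positivity)
  have hskew : 0 ≤ (1 - 2 * (1 / (Fintype.card F : ℝ) ^ t)) *
      (1 / (Fintype.card F : ℝ) ^ t * (1 - 1 / (Fintype.card F : ℝ) ^ t)) := by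
    -- For `t = 0` the factor 1 - 2p is negative, but p = 1 and the variance vanishes.
    rcases Nat.eq_zero_or_pos t with rfl | ht
    · simp
    · refine mul_nonneg ?_ (mul_nonneg hp0 hp1)
      have h2 : (2 : ℝ) ≤ (Fintype.card F : ℝ) ^ t :=
        hq.trans (le_self_pow₀ (by linarith) ht.ne')
      rw [sub_nonneg, mul_one_div]
      exact div_le_one_of_le₀ h2 (by positivity)
  obtain ⟨c, hc⟩ := exists_le_of_moments
    (fun c : Fin t → C => ∑ x, centredAgreement v (fun i => (c i : Fin n → F)) x)
    (σ := Real.sqrt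
      (n * (1 / (Fintype.card F : ℝ) ^ t * (1 - 1 / (Fintype.card F : ℝ) ^ t))))
    (by
      rw [Finset.sum_comm]
      exact Finset.sum_eq_zero fun x _ => sum_centredAgreement_eq_zero hC v x)
    (by
      rw [Real.sq_sqrt (by positivity)]
      simp only [sq, Finset.sum_mul_sum]
      rw [Finset.sum_comm]
      simp_rw [Finset.sum_comm (s := (Finset.univ : Finset (Fin t → C))),
        sum_centredAgreement_mul hC]
      simp
      ring)
    (by
      simp only [pow_succ' _ 2, sq, Finset.mul_sum, Finset.sum_mul]
      rw [Finset.sum_comm]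
      refine Finset.sum_nonneg fun x _ => ?_
      rw [Finset.sum_comm]
      refine Finset.sum_nonneg fun y _ => ?_
      rw [Finset.sum_comm]
      refine Finset.sum_nonneg fun z _ => ?_
      rw [sum_centredAgreement_mul_mul hC]
      split_ifs <;> positivity)
  refine ⟨fun i => c i, fun i => (c i).2, ?_⟩
  rw [sum_centredAgreement] at hc
  linarith

end Moments

/-! ### Strength of first-order Reed-Muller codes -/

section ReedMuller

theorem hasStrengthThree_of_separates {n : ℕ} {C : Submodule (ZMod 2) (Fin n → ZMod 2)}
    (h1 : 1 ∈ C) (hsep : ∀ x y : Fin n, x ≠ y → ∃ c ∈ C, c x ≠ c y) : HasStrengthThree C := by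
  have hsep' : ∀ x y : Fin n, x ≠ y → ∃ c ∈ C, c x = 1 ∧ c y = 0 := by
    intro x y hxy
    obtain ⟨c, hc, hcxy⟩ := hsep x y hxy
    by_cases hcx : c x = 1
    · refine ⟨c, hc, hcx, ?_⟩
      revert hcx hcxy
      generalize c x = a
      generalize c y = b
      revert a b
      decide
    · refine ⟨c + 1, C.add_mem hc h1, ?_⟩
      revert hcx hcxy
      simp only [Pi.add_apply, Pi.one_apply]
      generalize c x = a
      generalize c y = b
      revert a b
      decide
  have htriple : ∀ x y z : Fin n, x ≠ y → x ≠ z → ∃ c ∈ C, c x = 1 ∧ c y = 0 ∧ c z = 0 := by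
    intro x y z hxy hxz
    obtain ⟨a, ha, hax, hay⟩ := hsep' x y hxy
    obtain ⟨b, hb, hbx, hbz⟩ := hsep' x z hxz
    by_cases haz : a z = 0
    · exact ⟨a, ha, hax, hay, haz⟩
    by_cases hby : b y = 0
    · exact ⟨b, hb, hbx, hby, hbz⟩
    -- Here `a` is 1, 0, 1 and `b` is 1, 1, 0 at `x`, `y`, `z`.
    refine ⟨a + b + 1, C.add_mem (C.add_mem ha hb) h1, ?_⟩
    revert haz hby
    simp only [Pi.add_apply, Pi.one_apply, hax, hay, hbx, hbz]
    generalize a z = p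
    generalize b y = q
    revert p q
    decide
  intro S x hS hx
  rcases S.eq_empty_or_nonempty with rfl | ⟨y, hy⟩
  · exact ⟨1, h1, rfl, by simp⟩
  obtain ⟨z, hz⟩ : ∃ z, S.erase y ⊆ {z} := by
    have hcard : (S.erase y).card ≤ 1 := by
      rw [Finset.card_erase_of_mem hy]
      omega
    have : Nonempty (Fin n) := ⟨x⟩
    exact Finset.card_le_one_iff_subset_singleton.1 hcard
  -- If `S = {y}`, then `z` is arbitrary and may equal `x`.
  by_cases hxz : x = z
  · obtain ⟨c, hc, hcx, hcy, -⟩ := htriple x y y (fun h => hx (h ▸ hy)) (fun h => hx (h ▸ hy))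
    refine ⟨c, hc, hcx, fun w hw => ?_⟩
    by_cases hwy : w = y
    · rw [hwy, hcy]
    · exact absurd hw (Finset.mem_singleton.1 (hz (Finset.mem_erase.2 ⟨hwy, hw⟩)) ▸ hxz ▸ hx)
  · obtain ⟨c, hc, hcx, hcy, hcz⟩ := htriple x y z (fun h => hx (h ▸ hy)) hxz
    refine ⟨c, hc, hcx, fun w hw => ?_⟩
    by_cases hwy : w = y
    · rw [hwy, hcy]
    · rw [Finset.mem_singleton.1 (hz (Finset.mem_erase.2 ⟨hwy, hw⟩)), hcz]

theorem reedMuller_zero_right (m : ℕ) : reedMuller m 0 = repetitionCode (2 ^ m) := by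
  cases m <;> rfl

theorem reedMuller_succ_self (r : ℕ) : reedMuller (r + 1) (r + 1) = ⊤ := by
  simp [reedMuller]

theorem reedMuller_succ_succ {m r : ℕ} (h : r < m) :
    reedMuller (m + 1) (r + 1) = castCode (by rw [pow_succ, mul_two])
      (uuvCode (reedMuller m (r + 1)) (reedMuller m r)) := by
  rw [reedMuller, if_neg (Nat.not_le.2 h)]

theorem separates_uuvCode {n : ℕ} {C₁ C₂ : Submodule (ZMod 2) (Fin n → ZMod 2)}
    (h1 : 1 ∈ C₁) (h2 : 1 ∈ C₂) (hsep : ∀ x y : Fin n, x ≠ y → ∃ c ∈ C₁, c x ≠ c y) :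
    1 ∈ uuvCode C₁ C₂ ∧ ∀ x y : Fin (n + n), x ≠ y → ∃ c ∈ uuvCode C₁ C₂, c x ≠ c y := by
  have hu : ∀ u ∈ C₁, Fin.append u u ∈ uuvCode C₁ C₂ := fun u hu =>
    ⟨u, hu, 0, C₂.zero_mem, by rw [add_zero]⟩
  have hv : Fin.append (0 : Fin n → ZMod 2) 1 ∈ uuvCode C₁ C₂ :=
    ⟨0, C₁.zero_mem, 1, h2, by rw [zero_add]⟩
  refine ⟨?_, fun x y => ?_⟩
  · convert hu 1 h1 using 1
    funext j
    refine Fin.addCases (fun i => ?_) (fun i => ?_) j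
    · rw [Fin.append_left, Pi.one_apply, Pi.one_apply]
    · rw [Fin.append_right, Pi.one_apply, Pi.one_apply]
  · refine Fin.addCases (fun i => ?_) (fun i => ?_) x <;>
      refine Fin.addCases (fun j => ?_) (fun j => ?_) y <;> intro hxy
    · obtain ⟨c, hc, hcij⟩ := hsep i j (fun h => hxy (by rw [h]))
      exact ⟨_, hu c hc, by rwa [Fin.append_left, Fin.append_left]⟩
    · exact ⟨_, hv, by rw [Fin.append_left, Fin.append_right]; simp⟩
    · exact ⟨_, hv, by rw [Fin.append_left, Fin.append_right]; simp⟩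
    · obtain ⟨c, hc, hcij⟩ := hsep i j (fun h => hxy (by rw [h]))
      exact ⟨_, hu c hc, by rwa [Fin.append_right, Fin.append_right]⟩

theorem separates_castCode {n n' : ℕ} (h : n' = n) {C : Submodule (ZMod 2) (Fin n → ZMod 2)}
    (hC : 1 ∈ C ∧ ∀ x y : Fin n, x ≠ y → ∃ c ∈ C, c x ≠ c y) :
    1 ∈ castCode h C ∧ ∀ x y : Fin n', x ≠ y → ∃ c ∈ castCode h C, c x ≠ c y := by
  subst h
  exact hC

theorem separates_reedMuller_one (m : ℕ) :
    1 ∈ reedMuller (m + 1) 1 ∧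
      ∀ x y : Fin (2 ^ (m + 1)), x ≠ y → ∃ c ∈ reedMuller (m + 1) 1, c x ≠ c y := by
  induction m with
  | zero =>
    rw [reedMuller_succ_self 0]
    exact ⟨Submodule.mem_top, fun x y hxy => ⟨Pi.single x 1, Submodule.mem_top, by
      simp [Pi.single_eq_of_ne hxy.symm]⟩⟩
  | succ m ih =>
    rw [reedMuller_succ_succ m.succ_pos]
    refine separates_castCode _ (separates_uuvCode ih.1 ?_ ih.2)
    rw [reedMuller_zero_right]
    exact Or.inr rfl

/-! ### Recursion in the order and the error term -/

/-- The main term of the bound on `R_t(k + 1, m)`. -/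
noncomputable def radiusBound (t k m : ℕ) : ℝ :=
  (1 - 1 / (2 : ℝ) ^ t) * (2 : ℝ) ^ m
    - Real.sqrt ((2 : ℝ) ^ t - 1) / (2 : ℝ) ^ t * (1 + Real.sqrt 2) ^ k * (2 : ℝ) ^ ((m : ℝ) / 2)

theorem two_rpow_half (m : ℕ) : (2 : ℝ) ^ ((m : ℝ) / 2) = Real.sqrt (2 ^ m) := by
  rw [Real.sqrt_eq_rpow, ← Real.rpow_natCast, ← Real.rpow_mul zero_le_two, div_eq_mul_one_div]

/-- This is where 1 + √2 comes from: (1 + √2)√2 = (1 + √2) + 1. -/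
theorem radiusBound_succ_succ (t k m : ℕ) :
    radiusBound t (k + 1) (m + 1) = radiusBound t (k + 1) m + radiusBound t k m := by
  have h2 : Real.sqrt 2 * Real.sqrt 2 = 2 := Real.mul_self_sqrt zero_le_two
  simp only [radiusBound, two_rpow_half, pow_succ _ m, Real.sqrt_mul (pow_nonneg zero_le_two _)]
  linear_combination (-(Real.sqrt ((2 : ℝ) ^ t - 1) / (2 : ℝ) ^ t * (1 + Real.sqrt 2) ^ k *
    Real.sqrt (2 ^ m))) * h2

theorem rmRadius_one_le (t : ℕ) {m : ℕ} (hm : 1 ≤ m) :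
    (rmRadius t 1 m : ℝ) ≤ radiusBound t 0 m := by
  classical
  obtain ⟨m, rfl⟩ := Nat.exists_eq_add_of_le' hm
  have h := separates_reedMuller_one m
  have : Fintype (reedMuller (m + 1) 1) := Fintype.ofFinite _
  refine (coveringRadius_le_of_hasStrengthThree (t := t)
    (hasStrengthThree_of_separates h.1 h.2)).trans_eq ?_
  have hsqrt : Real.sqrt (2 ^ (m + 1) * (1 / 2 ^ t * (1 - 1 / 2 ^ t))) =
      Real.sqrt ((2 : ℝ) ^ t - 1) / 2 ^ t * Real.sqrt (2 ^ (m + 1)) := by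
    have : (2 : ℝ) ^ (m + 1) * (1 / 2 ^ t * (1 - 1 / 2 ^ t)) =
        ((2 : ℝ) ^ t - 1) / (2 ^ t) ^ 2 * 2 ^ (m + 1) := by
      field_simp
    rw [this, Real.sqrt_mul' _ (by positivity), Real.sqrt_div' _ (by positivity),
      Real.sqrt_sq (by positivity)]
  simp only [radiusBound, two_rpow_half, ZMod.card, Nat.cast_ofNat, Nat.cast_pow, hsqrt]
  ring

theorem rmRadius_self (t r : ℕ) : rmRadius t (r + 1) (r + 1) = 0 := by
  rw [rmRadius, reedMuller_succ_self, coveringRadius_top]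

theorem rmRadius_succ_succ_le (t : ℕ) {m r : ℕ} (h : r < m) :
    rmRadius t (r + 1) (m + 1) ≤ rmRadius t (r + 1) m + rmRadius t r m := by
  rw [rmRadius, reedMuller_succ_succ h, coveringRadius_castCode]
  exact coveringRadius_uuvCode_le _ _

theorem exists_rmRadius_le (t k : ℕ) :
    ∃ K : ℝ, 0 ≤ K ∧ ∀ m : ℕ, k + 2 ≤ m →
      (rmRadius t (k + 2) m : ℝ) ≤ radiusBound t (k + 1) m + K * (m : ℝ) ^ k := by
  induction k with
  | zero =>
    -- The radius is 0 at `m = 2`, but the main term may be negative there. The error then stays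
    -- constant, since order one contributes none.
    refine ⟨|radiusBound t 1 2|, abs_nonneg _, fun m hm => ?_⟩
    induction m, hm using Nat.le_induction with
    | base =>
      rw [rmRadius_self]
      have := neg_le_abs (radiusBound t 1 2)
      simp
      linarith
    | succ m hm ih =>
      have h : (rmRadius t 2 (m + 1) : ℝ) ≤ rmRadius t 2 m + rmRadius t 1 m := by
        exact_mod_cast rmRadius_succ_succ_le t (r := 1) (by omega)
      have h1 := rmRadius_one_le t (m := m) (by omega)
      have hB := radiusBound_succ_succ t 0 m
      simp only [zero_add, pow_zero, mul_one] at ih hB ⊢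
      linarith
  | succ k ihk =>
    obtain ⟨K, hK, hb⟩ := ihk
    refine ⟨max K |radiusBound t (k + 2) (k + 3)|, le_max_of_le_left hK, fun m hm => ?_⟩
    induction m, hm using Nat.le_induction with
    | base =>
      rw [rmRadius_self]
      have h1 := neg_le_abs (radiusBound t (k + 2) (k + 3))
      have h2 := le_max_right K |radiusBound t (k + 2) (k + 3)|
      have h3 : (1 : ℝ) ≤ ((k + 1 + 2 : ℕ) : ℝ) ^ (k + 1) :=
        one_le_pow₀ (by exact_mod_cast Nat.le_add_left 1 (k + 2))
      have h4 := le_mul_of_one_le_right (le_max_of_le_left (b := K)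
        (c := |radiusBound t (k + 2) (k + 3)|) hK) h3
      push_cast at h4 ⊢
      linarith
    | succ m hm ih =>
      have h : (rmRadius t (k + 1 + 2) (m + 1) : ℝ) ≤
          rmRadius t (k + 1 + 2) m + rmRadius t (k + 2) m := by
        exact_mod_cast rmRadius_succ_succ_le t (r := k + 2) (by omega)
      have h1 := hb m (by omega)
      have hB := radiusBound_succ_succ t (k + 1) m
      -- Each step in `m` adds an error of order m^k from the lower-order code, absorbed by the
      -- growth of m^(k+1).
      have hpow : (m : ℝ) ^ (k + 1) + (m : ℝ) ^ k ≤ ((m + 1 : ℕ) : ℝ) ^ (k + 1) := by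
        have : (m : ℝ) ^ k ≤ ((m : ℝ) + 1) ^ k :=
          pow_le_pow_left₀ (Nat.cast_nonneg m) (by linarith) k
        calc (m : ℝ) ^ (k + 1) + (m : ℝ) ^ k = (m : ℝ) ^ k * (m + 1) := by ring
          _ ≤ ((m : ℝ) + 1) ^ k * (m + 1) := by gcongr
          _ = ((m + 1 : ℕ) : ℝ) ^ (k + 1) := by push_cast; ring
      have h2 : K * (m : ℝ) ^ k ≤ max K |radiusBound t (k + 2) (k + 3)| * (m : ℝ) ^ k := by
        gcongr
        exact le_max_left _ _
      have h3 := mul_le_mul_of_nonneg_left hpow (le_max_of_le_left (b := K)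
        (c := |radiusBound t (k + 2) (k + 3)|) hK)
      linarith

end ReedMuller

end GenCovering

theorem mainTheorem1 (r t : ℕ) (hr : 1 ≤ r) :
    ∃ E : ℕ → ℝ, (E =O[atTop] fun m : ℕ => (m : ℝ) ^ ((r : ℤ) - 2)) ∧
      ∀ m : ℕ, r ≤ m →
        (GenCovering.rmRadius t r m : ℝ) ≤
          (1 - 1 / (2 : ℝ) ^ t) * (2 : ℝ) ^ m
            - Real.sqrt ((2 : ℝ) ^ t - 1) / (2 : ℝ) ^ t * (1 + Real.sqrt 2) ^ (r - 1)
                * (2 : ℝ) ^ ((m : ℝ) / 2)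
            + E m := by
  obtain rfl | ⟨k, rfl⟩ : r = 1 ∨ ∃ k, r = k + 2 := by
    rcases hr.eq_or_lt with h | h
    · exact Or.inl h.symm
    · exact Or.inr (Nat.exists_eq_add_of_le' h)
  · refine ⟨fun _ => 0, isBigO_zero _ _, fun m hm => ?_⟩
    simpa [GenCovering.radiusBound] using GenCovering.rmRadius_one_le t hm
  · obtain ⟨K, -, hK⟩ := GenCovering.exists_rmRadius_le t k
    refine ⟨fun m => K * (m : ℝ) ^ k, ?_, hK⟩
    have : ((k + 2 : ℕ) : ℤ) - 2 = k := by push_cast; ring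
    simp only [this, zpow_natCast]
    exact (isBigO_refl _ _).const_mul_left K
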